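/- Let $n=r+s$ with $r,s\ge 0$, let $A,N_1,\dots,N_m\in\mathbb R^{n\times n}$, $X_0\in\mathbb R^{n\times q}$, $C\in\mathbb R^{p\times n}$, with $A$ Hurwitz (all eigenvalues in $\mathbb C_-=\{z\in\mathbb C:\operatorname{Re} z<0\}$), and consider the homogeneous bilinear system $\dot x=Ax+\sum_{k=1}^m N_kx\,u_k$, $x(0)=X_0v_0$, $y=Cx$. Let $\gamma>0$ be such that $$\sigma\Big(A\otimes I+I\otimes A+\tfrac1{\gamma^2}\sum_{k=1}^m N_k\otimes N_k\Big)\subset\mathbb C_- .$$ Its Gramians are $P_0=\int_0^\infty Z_\gamma(t)\,dt$ and $Q=\int_0^\infty Z^*_\gamma(t)\,dt$, where, on $[0,\infty)$, $$\dot Z_\gamma=AZ_\gamma+Z_\gamma A^\top+\tfrac1{\gamma^2}\sum_{k=1}^m N_kZ_\gamma N_k^\top,\quad Z_\gamma(0)=X_0X_0^\top,$$ $$\dot Z^*_\gamma=A^\top Z^*_\gamma+Z^*_\gamma A+\tfrac1{\gamma^2}\sum_{k=1}^m N_k^\top Z^*_\gamma N_k,\quad Z^*_\gamma(0)=C^\top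 C.$$ Let $\mathcal S\in\mathbb R^{n\times n}$ be an invertible matrix such that $$\mathcal SP_0\mathcal S^\top=\mathcal S^{-\top}Q\mathcal S^{-1}=\Theta=\begin{pmatrix}\Theta_1&\\&\Theta_2\end{pmatrix}$$ is diagonal with $\Theta_1\in\mathbb R^{r\times r}$ and $\Theta_1>0$, and partition $$\mathcal SA\mathcal S^{-1}=\begin{pmatrix}\mathcal A_{11}&\mathcal A_{12}\\\mathcal A_{21}&\mathcal A_{22}\end{pmatrix},\quad \mathcal SN_k\mathcal S^{-1}=\begin{pmatrix}\mathcal N_{k,11}&\mathcal N_{k,12}\\\mathcal N_{k,21}&\mathcal N_{k,22}\end{pmatrix},\quad \mathcal SX_0=\begin{pmatrix}X_{0,1}\\X_{0,2}\end{pmatrix},\quad C\mathcal S^{-1}=\begin{pmatrix}\mathcal C_1&\mathcal C_2\end{pmatrix}$$ accordingly. For a reduced system with coefficients $(\tilde A,\tilde X_0,\tilde C,\tilde N_k)$ of order $r$ let $\tilde Z_\gamma$ and $\tilde Z_\gamma^*$ be the solutions on $[0,\infty)$ of $$\dot{\tilde Z}_\gamma=\tilde A\tilde Z_\gamma+\tilde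 Z_\gamma\tilde A^\top+\tfrac1{\gamma^2}\sum_{k=1}^m\tilde N_k\tilde Z_\gamma\tilde N_k^\top,\quad \tilde Z_\gamma(0)=\tilde X_0\tilde X_0^\top,$$ $$\dot{\tilde Z}{}^*_\gamma=\tilde A^\top\tilde Z^*_\gamma+\tilde Z^*_\gamma\tilde A+\tfrac1{\gamma^2}\sum_{k=1}^m\tilde N_k^\top\tilde Z^*_\gamma\tilde N_k,\quad \tilde Z^*_\gamma(0)=\tilde C^\top\tilde C.$$ (a) (Balanced truncation) If $(\tilde A,\tilde X_0,\tilde C,\tilde N_k)=(\mathcal A_{11},X_{0,1},\mathcal C_1,\mathcal N_{k,11})$, then both Gramians $\tilde P=\int_0^\infty\tilde Z_\gamma(t)\,dt$ and $\tilde Q=\int_0^\infty\tilde Z^*_\gamma(t)\,dt$ exist, i.e. $\tilde Z_\gamma$ and $\tilde Z^*_\gamma$ are integrable over $(0,\infty)$. (b) (Singular perturbation approximation) If $\mathcal A_{22}$ is invertible and $$(\tilde A,\tilde X_0,\tilde C,\tilde N_k)=\big(\mathcal A_{11}-\mathcal A_{12}\mathcal A_{22}^{-1}\mathcal A_{21},\;X_{0,1},\;\mathcal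 C_1-\mathcal C_2\mathcal A_{22}^{-1}\mathcal A_{21},\;\mathcal N_{k,11}-\mathcal N_{k,12}\mathcal A_{22}^{-1}\mathcal A_{21}\big),$$ then the Gramian $\tilde Q=\int_0^\infty\tilde Z^*_\gamma(t)\,dt$ exists, i.e. $\tilde Z^*_\gamma$ is integrable over $(0,\infty)$. -/

import Mathlib

open scoped Matrix Kronecker

noncomputable section

/-- The coefficients `(A, N₁, …, N_m, X₀, C)` of a homogeneous bilinear system
`x' = A x + ∑ k, N k x u_k`, `x(0) = X₀ v₀`, `y = C x`
of order `n` with `m` controls, initial states in the range of `X₀ ∈ ℝ^{n×q}` and `p` outputs. -/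
structure HomBilinearSystem (n m q p : ℕ) where
  A : Matrix (Fin n) (Fin n) ℝ
  N : Fin m → Matrix (Fin n) (Fin n) ℝ
  X₀ : Matrix (Fin n) (Fin q) ℝ
  C : Matrix (Fin p) (Fin n) ℝ

/-- A real square matrix all of whose complex eigenvalues have negative real part. -/
def IsHurwitzMatrix {ι : Type*} [Fintype ι] [DecidableEq ι] (M : Matrix ι ι ℝ) : Prop :=
  ∀ z ∈ spectrum ℂ (M.map (algebraMap ℝ ℂ)), z.re < 0

/-- The generalized Lyapunov operator `Z ↦ A Z + Z Aᵀ + γ⁻² ∑ k, N k Z (N k)ᵀ`. -/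
def genLyapunov {n m : ℕ} (A : Matrix (Fin n) (Fin n) ℝ) (N : Fin m → Matrix (Fin n) (Fin n) ℝ)
    (γ : ℝ) (Z : Matrix (Fin n) (Fin n) ℝ) : Matrix (Fin n) (Fin n) ℝ :=
  A * Z + Z * Aᵀ + (1 / γ ^ 2) • ∑ k, N k * Z * (N k)ᵀ

/-- `Z` solves `Z' = A Z + Z Aᵀ + γ⁻² ∑ k, N k Z (N k)ᵀ` on `[0, ∞)` with `Z(0) = K`
(derivatives are taken entrywise, one-sided at `t = 0`). -/
def SolvesGenLyapunovODE {n m : ℕ} (A : Matrix (Fin n) (Fin n) ℝ)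
    (N : Fin m → Matrix (Fin n) (Fin n) ℝ) (γ : ℝ) (K : Matrix (Fin n) (Fin n) ℝ)
    (Z : ℝ → Matrix (Fin n) (Fin n) ℝ) : Prop :=
  Z 0 = K ∧ ∀ t : ℝ, 0 ≤ t → ∀ i j,
    HasDerivWithinAt (fun s => Z s i j) (genLyapunov A N γ (Z t) i j) (Set.Ici 0) t

/-- `P = ∫₀^∞ Z(s) ds` as a convergent (entrywise Lebesgue) integral, `Z` being the solution of the
generalized Lyapunov differential equation with initial value `K`: a solution exists, and every
solution is integrable over `(0, ∞)` with integral `P`. -/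
def IsLyapunovIntegral {n m : ℕ} (A : Matrix (Fin n) (Fin n) ℝ)
    (N : Fin m → Matrix (Fin n) (Fin n) ℝ) (γ : ℝ) (K P : Matrix (Fin n) (Fin n) ℝ) : Prop :=
  (∃ Z, SolvesGenLyapunovODE A N γ K Z) ∧
    ∀ Z, SolvesGenLyapunovODE A N γ K Z → ∀ i j,
      MeasureTheory.IntegrableOn (fun s => Z s i j) (Set.Ioi 0) ∧
        ∫ s in Set.Ioi (0 : ℝ), Z s i j = P i j

namespace HomBilinearSystem

variable {n m q p : ℕ}

/-- The matrix `A ⊗ I + I ⊗ A + γ⁻² ∑ k, N k ⊗ N k`. -/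
def kroneckerMatrix (sys : HomBilinearSystem n m q p) (γ : ℝ) :
    Matrix (Fin n × Fin n) (Fin n × Fin n) ℝ :=
  sys.A ⊗ₖ (1 : Matrix (Fin n) (Fin n) ℝ) + (1 : Matrix (Fin n) (Fin n) ℝ) ⊗ₖ sys.A
    + (1 / γ ^ 2) • ∑ k, sys.N k ⊗ₖ sys.N k

/-- `P = ∫₀^∞ Z(s) ds`, where
`Z' = A Z + Z Aᵀ + γ⁻² ∑ k, N k Z (N k)ᵀ`, `Z(0) = X₀ X₀ᵀ`. -/
def IsReachabilityGramian (sys : HomBilinearSystem n m q p) (γ : ℝ)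
    (P : Matrix (Fin n) (Fin n) ℝ) : Prop :=
  IsLyapunovIntegral sys.A sys.N γ (sys.X₀ * sys.X₀ᵀ) P

/-- `Q = ∫₀^∞ Z(s) ds`, where
`Z' = Aᵀ Z + Z A + γ⁻² ∑ k, (N k)ᵀ Z (N k)`, `Z(0) = Cᵀ C`. -/
def IsObservabilityGramian (sys : HomBilinearSystem n m q p) (γ : ℝ)
    (Q : Matrix (Fin n) (Fin n) ℝ) : Prop :=
  IsLyapunovIntegral sys.Aᵀ (fun k => (sys.N k)ᵀ) γ (sys.Cᵀ * sys.C) Q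

/-- The realization `(S A S⁻¹, S N_k S⁻¹, S X₀, C S⁻¹)` in the coordinates `S x`. -/
def transform (sys : HomBilinearSystem n m q p) (S : Matrix (Fin n) (Fin n) ℝ) :
    HomBilinearSystem n m q p where
  A := S * sys.A * S⁻¹
  N := fun k => S * sys.N k * S⁻¹
  X₀ := S * sys.X₀
  C := sys.C * S⁻¹

/-- The invertible matrix `S` diagonalizes the two matrices `P` and `Q` simultaneously:
`S P Sᵀ = S⁻ᵀ Q S⁻¹ = diag θ`. -/
def IsBalancingTransformation (P Q S : Matrix (Fin n) (Fin n) ℝ) (θ : Fin n → ℝ) : Prop :=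
  IsUnit S.det ∧ S * P * Sᵀ = Matrix.diagonal θ ∧ (S⁻¹)ᵀ * Q * S⁻¹ = Matrix.diagonal θ

/-! Blocks of a matrix partitioned after its first `r` rows and / or columns. -/

section Blocks

variable {r s : ℕ}

def block₁₁ (M : Matrix (Fin (r + s)) (Fin (r + s)) ℝ) : Matrix (Fin r) (Fin r) ℝ :=
  M.submatrix (Fin.castAdd s) (Fin.castAdd s)

def block₁₂ (M : Matrix (Fin (r + s)) (Fin (r + s)) ℝ) : Matrix (Fin r) (Fin s) ℝ :=
  M.submatrix (Fin.castAdd s) (Fin.natAdd r)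

def block₂₁ (M : Matrix (Fin (r + s)) (Fin (r + s)) ℝ) : Matrix (Fin s) (Fin r) ℝ :=
  M.submatrix (Fin.natAdd r) (Fin.castAdd s)

def block₂₂ (M : Matrix (Fin (r + s)) (Fin (r + s)) ℝ) : Matrix (Fin s) (Fin s) ℝ :=
  M.submatrix (Fin.natAdd r) (Fin.natAdd r)

def topRows (M : Matrix (Fin (r + s)) (Fin q) ℝ) : Matrix (Fin r) (Fin q) ℝ :=
  M.submatrix (Fin.castAdd s) id

def leftCols (M : Matrix (Fin p) (Fin (r + s)) ℝ) : Matrix (Fin p) (Fin r) ℝ :=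
  M.submatrix id (Fin.castAdd s)

def rightCols (M : Matrix (Fin p) (Fin (r + s)) ℝ) : Matrix (Fin p) (Fin s) ℝ :=
  M.submatrix id (Fin.natAdd r)

/-- The reduced system of order `r` obtained by truncation (`x₂ = 0`):
`(A₁₁, N_{k,11}, X₀,₁, C₁)`. -/
def truncation (sys : HomBilinearSystem (r + s) m q p) : HomBilinearSystem r m q p where
  A := block₁₁ sys.A
  N := fun k => block₁₁ (sys.N k)
  X₀ := topRows sys.X₀
  C := leftCols sys.C

/-- The reduced system of order `r` obtained by singular perturbation
(`x₂ = - A₂₂⁻¹ A₂₁ x₁`), meaningful for invertible `A₂₂`: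
`(A₁₁ - A₁₂ A₂₂⁻¹ A₂₁, N_{k,11} - N_{k,12} A₂₂⁻¹ A₂₁, X₀,₁, C₁ - C₂ A₂₂⁻¹ A₂₁)`. -/
def singularPerturbation (sys : HomBilinearSystem (r + s) m q p) : HomBilinearSystem r m q p where
  A := block₁₁ sys.A - block₁₂ sys.A * (block₂₂ sys.A)⁻¹ * block₂₁ sys.A
  N := fun k => block₁₁ (sys.N k) - block₁₂ (sys.N k) * (block₂₂ sys.A)⁻¹ * block₂₁ sys.A
  X₀ := topRows sys.X₀
  C := leftCols sys.C - rightCols sys.C * (block₂₂ sys.A)⁻¹ * block₂₁ sys.A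

end Blocks

end HomBilinearSystem

end

/-!
Write `L Z = A Z + Z Aᵀ + γ⁻² ∑ k, N k Z (N k)ᵀ`, so that the solution of the Lyapunov differential
equation with initial value `K` is `exp (t L) K`.

The semigroup `exp (t L)` maps positive semidefinite matrices to positive semidefinite matrices
(`preservesPosSemidef_exp_genLyapunovCLM`). Indeed, for `h > 0` the perturbation `Z ↦ L Z + h A Z Aᵀ`
equals `h⁻¹ (F - 1)` with the positivity preserving operator
`F Z = (1 + h A) Z (1 + h A)ᵀ + h γ⁻² ∑ k, N k Z (N k)ᵀ`, so its exponential is a positive multiple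
of the power series `exp (t h⁻¹ F)`; now let `h → 0`.

Consequently a positive semidefinite `Θ` with `L Θ ≤ -K` forces the orbit of `K ≥ 0` to be
integrable: `tr (exp (t L) Θ)` is nonnegative and decreases at least at the rate
`tr (exp (t L) K)`, and the trace dominates all entries of a positive semidefinite matrix
(`exists_isLyapunovIntegral_of_supersolution`).

Such a `Θ` for the reduced systems is the block `Θ₁` of the balanced Gramian. The Gramians of the
full system are positive semidefinite and solve `L P = -K`
(`IsLyapunovIntegral.genLyapunov_eq`), and balancing turns this into an equation for
`diag (Θ₁, Θ₂)`. Multiplying it by `T = (1 X)` and `Tᵀ` gives the reduced equation for `Θ₁` up to a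
semidefinite term of the right sign (`exists_isLyapunovIntegral_compression`). Truncation is the
case `X = 0`; singular perturbation is the case `X = -(A₂₂⁻¹ A₂₁)ᵀ` for the observability equation,
where `(1 X) Aᵀ` has vanishing right block, so that the terms mixing `Θ₂` into the drift disappear.
-/

/-! ### Positive semidefinite real matrices -/

namespace Matrix

variable {ι κ : Type*} [Fintype ι] [Fintype κ]

theorem PosSemidef.mul_mul_transpose_same {M : Matrix ι ι ℝ} (hM : M.PosSemidef)
    (B : Matrix κ ι ℝ) : (B * M * Bᵀ).PosSemidef := by
  simpa [conjTranspose_eq_transpose_of_trivial] using hM.mul_mul_conjTranspose_same B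

theorem posSemidef_self_mul_transpose (B : Matrix ι κ ℝ) : (B * Bᵀ).PosSemidef := by
  simpa [conjTranspose_eq_transpose_of_trivial] using posSemidef_self_mul_conjTranspose B

theorem isClosed_setOf_posSemidef : IsClosed {M : Matrix ι ι ℝ | M.PosSemidef} := by
  simp only [posSemidef_iff_dotProduct_mulVec, Set.ofPred_and, Set.ofPred_forall]
  refine (isClosed_eq (by fun_prop) continuous_id).inter (isClosed_iInter fun x => ?_)
  exact isClosed_le continuous_const (by fun_prop)

/-- The entries of a positive semidefinite matrix are dominated by its trace, because
`2 |M i j| ≤ M i i + M j j`. -/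
theorem PosSemidef.abs_apply_le_trace [DecidableEq ι] {M : Matrix ι ι ℝ} (hM : M.PosSemidef)
    (i j : ι) : |M i j| ≤ M.trace := by
  have hd : ∀ k, 0 ≤ M k k := fun k => hM.diag_nonneg
  have hle : ∀ k, M k k ≤ M.trace := fun k =>
    Finset.single_le_sum (f := fun k => M k k) (fun l _ => hd l) (Finset.mem_univ k)
  have hsymm : M j i = M i j := by simpa using hM.1.apply i j
  have hq : ∀ c : ℝ, 0 ≤ M i i + c * (2 * M i j) + c ^ 2 * M j j := by
    intro c
    have h := hM.dotProduct_mulVec_nonneg (Pi.single i 1 + c • Pi.single j 1)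
    simp [mulVec_add, mulVec_smul, add_dotProduct, dotProduct_add, smul_dotProduct,
      hsymm] at h
    linarith
  rw [abs_le]
  constructor <;> linarith [hq 1, hq (-1), hle i, hle j]

end Matrix

/-! ### The semigroup generated by the generalized Lyapunov operator -/

noncomputable section

open scoped Matrix.Norms.Elementwise

/-- The topology of the elementwise norm. It is the product topology, but only this form of it is
recognized by instance search as the one underlying the norm. -/
local instance matrixNormTopology (n : ℕ) : TopologicalSpace (Matrix (Fin n) (Fin n) ℝ) :=
  PseudoMetricSpace.toUniformSpace.toTopologicalSpace

/-- A linear map of real square matrices is positivity preserving if it maps positive semidefinite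
matrices to positive semidefinite ones. -/
def PreservesPosSemidef {n : ℕ}
    (F : Matrix (Fin n) (Fin n) ℝ →L[ℝ] Matrix (Fin n) (Fin n) ℝ) : Prop :=
  ∀ Z : Matrix (Fin n) (Fin n) ℝ, Z.PosSemidef → (F Z).PosSemidef

/-- The generalized Lyapunov operator as a continuous linear map. -/
def genLyapunovCLM {n m : ℕ} (A : Matrix (Fin n) (Fin n) ℝ)
    (N : Fin m → Matrix (Fin n) (Fin n) ℝ) (γ : ℝ) :
    Matrix (Fin n) (Fin n) ℝ →L[ℝ] Matrix (Fin n) (Fin n) ℝ :=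
  LinearMap.toContinuousLinearMap
    { toFun := genLyapunov A N γ
      map_add' := fun X Y => by
        simp only [genLyapunov, Matrix.mul_add, Matrix.add_mul, Finset.sum_add_distrib, smul_add]
        abel
      map_smul' := fun c X => by
        simp only [genLyapunov, Matrix.mul_smul, Matrix.smul_mul, ← Finset.smul_sum, smul_add,
          RingHom.id_apply, smul_comm c] }

/-- The map `Z ↦ B Z Bᵀ` as a continuous linear map. -/
def congruenceCLM {n : ℕ} (B : Matrix (Fin n) (Fin n) ℝ) :
    Matrix (Fin n) (Fin n) ℝ →L[ℝ] Matrix (Fin n) (Fin n) ℝ :=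
  LinearMap.toContinuousLinearMap
    { toFun := fun Z => B * Z * Bᵀ
      map_add' := fun X Y => by simp only [Matrix.mul_add, Matrix.add_mul]
      map_smul' := fun c X => by simp only [Matrix.mul_smul, Matrix.smul_mul, RingHom.id_apply] }

section Semigroup

variable {n m : ℕ} {A : Matrix (Fin n) (Fin n) ℝ} {N : Fin m → Matrix (Fin n) (Fin n) ℝ} {γ : ℝ}

@[simp]
theorem genLyapunovCLM_apply (Z : Matrix (Fin n) (Fin n) ℝ) :
    genLyapunovCLM A N γ Z = genLyapunov A N γ Z := rfl

@[simp]
theorem congruenceCLM_apply (B Z : Matrix (Fin n) (Fin n) ℝ) :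
    congruenceCLM B Z = B * Z * Bᵀ := rfl

theorem PreservesPosSemidef.exp {F : Matrix (Fin n) (Fin n) ℝ →L[ℝ] Matrix (Fin n) (Fin n) ℝ}
    (hF : PreservesPosSemidef F) : PreservesPosSemidef (NormedSpace.exp F) := by
  intro Z hZ
  have hpow : ∀ k : ℕ, ((F ^ k) Z).PosSemidef := by
    intro k
    induction k with
    | zero => simpa using hZ
    | succ k ih => rw [pow_succ']; exact hF _ ih
  have hsum := (NormedSpace.exp_series_hasSum_exp' (𝕂 := ℝ) F).mapL
    (ContinuousLinearMap.apply ℝ (Matrix (Fin n) (Fin n) ℝ) Z)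
  refine Matrix.isClosed_setOf_posSemidef.mem_of_tendsto hsum (Filter.Eventually.of_forall ?_)
  intro s
  refine Matrix.posSemidef_sum s fun k _ => ?_
  exact (hpow k).smul (inv_nonneg.2 (Nat.cast_nonneg (α := ℝ) _))

/-- For `h > 0` the operator `Z ↦ L Z + h A Z Aᵀ` equals `h⁻¹ (F - 1)` with the positivity preserving
operator `F Z = (1 + h A) Z (1 + h A)ᵀ + h γ⁻² ∑ k, N k Z (N k)ᵀ`, so that its exponential is a
positive multiple of `exp (h⁻¹ F)`. -/
theorem preservesPosSemidef_exp_perturbed (A : Matrix (Fin n) (Fin n) ℝ)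
    (N : Fin m → Matrix (Fin n) (Fin n) ℝ) (γ : ℝ) {t h : ℝ} (ht : 0 ≤ t) (hh : 0 < h) :
    PreservesPosSemidef
      (NormedSpace.exp (t • (genLyapunovCLM A N γ + h • congruenceCLM A))) := by
  set F : Matrix (Fin n) (Fin n) ℝ →L[ℝ] Matrix (Fin n) (Fin n) ℝ :=
    congruenceCLM (1 + h • A) + (h * (1 / γ ^ 2)) • ∑ k, congruenceCLM (N k) with hFdef
  have hF : PreservesPosSemidef ((t / h) • F) := by
    intro Z hZ
    simp only [hFdef, _root_.add_apply, _root_.smul_apply, sum_apply,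
      congruenceCLM_apply]
    refine ((hZ.mul_mul_transpose_same _).add (Matrix.PosSemidef.smul ?_ ?_)).smul ?_
    · exact Matrix.posSemidef_sum _ fun k _ => hZ.mul_mul_transpose_same _
    · positivity
    · positivity
  have hsplit : t • (genLyapunovCLM A N γ + h • congruenceCLM A)
      = (t / h) • F + algebraMap ℝ _ (-(t / h)) := by
    ext1 Z
    simp only [hFdef, Algebra.algebraMap_eq_smul_one, _root_.add_apply, _root_.smul_apply,
      sum_apply, congruenceCLM_apply, genLyapunovCLM_apply, genLyapunov,
      one_apply_eq_self, Matrix.add_mul, Matrix.mul_add, Matrix.transpose_add,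
      Matrix.transpose_smul, Matrix.transpose_one, Matrix.one_mul, Matrix.mul_one,
      Matrix.smul_mul, Matrix.mul_smul]
    match_scalars <;> field_simp
    ring
  let _ : NormedAlgebra ℚ (Matrix (Fin n) (Fin n) ℝ →L[ℝ] Matrix (Fin n) (Fin n) ℝ) :=
    NormedAlgebra.restrictScalars ℚ ℝ _
  intro Z hZ
  rw [hsplit, NormedSpace.exp_add_of_commute (Algebra.commutes' _ _).symm,
    ← NormedSpace.algebraMap_exp_comm, Algebra.algebraMap_eq_smul_one, mul_smul_comm, mul_one]
  refine (hF.exp Z hZ).smul (a := NormedSpace.exp (-(t / h))) ?_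
  rw [← Real.exp_eq_exp_ℝ]
  exact (Real.exp_pos _).le

/-- The semigroup generated by the generalized Lyapunov operator preserves positivity. -/
theorem preservesPosSemidef_exp_genLyapunovCLM (A : Matrix (Fin n) (Fin n) ℝ)
    (N : Fin m → Matrix (Fin n) (Fin n) ℝ) (γ : ℝ) {t : ℝ} (ht : 0 ≤ t) :
    PreservesPosSemidef (NormedSpace.exp (t • genLyapunovCLM A N γ)) := by
  let _ : NormedAlgebra ℚ (Matrix (Fin n) (Fin n) ℝ →L[ℝ] Matrix (Fin n) (Fin n) ℝ) :=
    NormedAlgebra.restrictScalars ℚ ℝ _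
  intro Z hZ
  have hcont : Continuous fun h : ℝ =>
      NormedSpace.exp (t • (genLyapunovCLM A N γ + h • congruenceCLM A)) Z :=
    ((NormedSpace.exp_continuous (𝔸 := Matrix (Fin n) (Fin n) ℝ →L[ℝ]
      Matrix (Fin n) (Fin n) ℝ)).comp (by fun_prop)).clm_apply continuous_const
  have hlim := (hcont.tendsto 0).mono_left (nhdsWithin_le_nhds (s := Set.Ioi 0))
  rw [zero_smul, add_zero] at hlim
  refine Matrix.isClosed_setOf_posSemidef.mem_of_tendsto hlim ?_
  filter_upwards [self_mem_nhdsWithin] with h hh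
  exact preservesPosSemidef_exp_perturbed A N γ ht hh Z hZ

/-! ### Solutions of the generalized Lyapunov differential equation -/

theorem hasDerivAt_exp_genLyapunovCLM (K : Matrix (Fin n) (Fin n) ℝ) (t : ℝ) :
    HasDerivAt (fun s : ℝ => NormedSpace.exp (s • genLyapunovCLM A N γ) K)
      (genLyapunov A N γ (NormedSpace.exp (t • genLyapunovCLM A N γ) K)) t := by
  simpa using (hasDerivAt_exp_smul_const' (𝕂 := ℝ) (genLyapunovCLM A N γ) t).clm_apply
    (hasDerivAt_const t K)

/-- On the orbits of the semigroup the generator may also be applied first. -/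
theorem hasDerivAt_exp_genLyapunovCLM' (K : Matrix (Fin n) (Fin n) ℝ) (t : ℝ) :
    HasDerivAt (fun s : ℝ => NormedSpace.exp (s • genLyapunovCLM A N γ) K)
      (NormedSpace.exp (t • genLyapunovCLM A N γ) (genLyapunov A N γ K)) t := by
  simpa using (hasDerivAt_exp_smul_const (𝕂 := ℝ) (genLyapunovCLM A N γ) t).clm_apply
    (hasDerivAt_const t K)

theorem hasDerivWithinAt_matrix_iff {Z : ℝ → Matrix (Fin n) (Fin n) ℝ}
    {Z' : Matrix (Fin n) (Fin n) ℝ} {s : Set ℝ} {t : ℝ} :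
    HasDerivWithinAt Z Z' s t ↔ ∀ i j, HasDerivWithinAt (fun u => Z u i j) (Z' i j) s t :=
  hasDerivWithinAt_pi.trans (forall_congr' fun _ => hasDerivWithinAt_pi)

theorem integrable_matrix_iff {Z : ℝ → Matrix (Fin n) (Fin n) ℝ}
    {μ : MeasureTheory.Measure ℝ} :
    MeasureTheory.Integrable Z μ ↔ ∀ i j, MeasureTheory.Integrable (fun u => Z u i j) μ :=
  MeasureTheory.integrable_pi_iff.trans (forall_congr' fun _ => MeasureTheory.integrable_pi_iff)

theorem integral_matrix_apply {Z : ℝ → Matrix (Fin n) (Fin n) ℝ}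
    {μ : MeasureTheory.Measure ℝ} (hZ : MeasureTheory.Integrable Z μ) (i j : Fin n) :
    (∫ u, Z u ∂μ) i j = ∫ u, Z u i j ∂μ :=
  ((Matrix.entryLinearMap ℝ ℝ i j).toContinuousLinearMap.integral_comp_comm hZ).symm

theorem solvesGenLyapunovODE_exp (K : Matrix (Fin n) (Fin n) ℝ) :
    SolvesGenLyapunovODE A N γ K
      (fun t : ℝ => NormedSpace.exp (t • genLyapunovCLM A N γ) K) :=
  ⟨by simp, fun t _ => hasDerivWithinAt_matrix_iff.1
    (hasDerivAt_exp_genLyapunovCLM K t).hasDerivWithinAt⟩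

theorem SolvesGenLyapunovODE.eq_exp {K : Matrix (Fin n) (Fin n) ℝ}
    {Z : ℝ → Matrix (Fin n) (Fin n) ℝ} (hZ : SolvesGenLyapunovODE A N γ K Z) {t : ℝ}
    (ht : 0 ≤ t) : Z t = NormedSpace.exp (t • genLyapunovCLM A N γ) K := by
  have hd : ∀ Y : ℝ → Matrix (Fin n) (Fin n) ℝ, SolvesGenLyapunovODE A N γ K Y →
      ∀ u, 0 ≤ u → HasDerivWithinAt Y (genLyapunovCLM A N γ (Y u)) (Set.Ici 0) u :=
    fun Y hY u hu => hasDerivWithinAt_matrix_iff.2 (hY.2 u hu)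
  have hc : ∀ Y : ℝ → Matrix (Fin n) (Fin n) ℝ, SolvesGenLyapunovODE A N γ K Y →
      ContinuousOn Y (Set.Icc 0 t) := fun Y hY u hu =>
    (hd Y hY u hu.1).continuousWithinAt.mono Set.Icc_subset_Ici_self
  have hr : ∀ Y : ℝ → Matrix (Fin n) (Fin n) ℝ, SolvesGenLyapunovODE A N γ K Y →
      ∀ u ∈ Set.Ico 0 t, HasDerivWithinAt Y (genLyapunovCLM A N γ (Y u)) (Set.Ici u) u :=
    fun Y hY u hu => (hd Y hY u hu.1).mono (Set.Ici_subset_Ici.2 hu.1)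
  have hE := solvesGenLyapunovODE_exp (A := A) (N := N) (γ := γ) K
  exact ODE_solution_unique (v := fun _ => genLyapunovCLM A N γ)
    (fun _ => (genLyapunovCLM A N γ).lipschitz) (hc Z hZ) (hr Z hZ) (hc _ hE) (hr _ hE)
    (hZ.1.trans hE.1.symm) (Set.right_mem_Icc.2 ht)

theorem IsLyapunovIntegral.integrableOn_exp {K P : Matrix (Fin n) (Fin n) ℝ}
    (hP : IsLyapunovIntegral A N γ K P) :
    MeasureTheory.IntegrableOn
      (fun t : ℝ => NormedSpace.exp (t • genLyapunovCLM A N γ) K) (Set.Ioi 0) :=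
  integrable_matrix_iff.2 fun i j => (hP.2 _ (solvesGenLyapunovODE_exp K) i j).1

theorem IsLyapunovIntegral.eq_integral_exp {K P : Matrix (Fin n) (Fin n) ℝ}
    (hP : IsLyapunovIntegral A N γ K P) :
    P = ∫ t in Set.Ioi (0 : ℝ), NormedSpace.exp (t • genLyapunovCLM A N γ) K := by
  ext i j
  rw [integral_matrix_apply hP.integrableOn_exp]
  exact (hP.2 _ (solvesGenLyapunovODE_exp K) i j).2.symm

theorem isLyapunovIntegral_of_integrableOn_exp {K : Matrix (Fin n) (Fin n) ℝ}
    (hK : MeasureTheory.IntegrableOn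
      (fun t : ℝ => NormedSpace.exp (t • genLyapunovCLM A N γ) K) (Set.Ioi 0)) :
    IsLyapunovIntegral A N γ K
      (∫ t in Set.Ioi (0 : ℝ), NormedSpace.exp (t • genLyapunovCLM A N γ) K) := by
  refine ⟨⟨_, solvesGenLyapunovODE_exp K⟩, fun Z hZ i j => ?_⟩
  have hEq : Set.EqOn (fun t => NormedSpace.exp (t • genLyapunovCLM A N γ) K i j)
      (fun t => Z t i j) (Set.Ioi (0 : ℝ)) := fun t ht => by
    simp only [hZ.eq_exp (le_of_lt ht)]
  refine ⟨MeasureTheory.IntegrableOn.congr_fun (integrable_matrix_iff.1 hK i j) hEq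
    measurableSet_Ioi, ?_⟩
  rw [integral_matrix_apply hK]
  exact (MeasureTheory.setIntegral_congr_fun measurableSet_Ioi hEq).symm

/-- The Lyapunov integral solves the algebraic generalized Lyapunov equation: since the orbit and
its derivative are integrable, the orbit tends to `0`, and the fundamental theorem of calculus
applies on the half line. -/
theorem IsLyapunovIntegral.genLyapunov_eq {K P : Matrix (Fin n) (Fin n) ℝ}
    (hP : IsLyapunovIntegral A N γ K P) : genLyapunov A N γ P = -K := by
  have hint := hP.integrableOn_exp
  have hint' := (genLyapunovCLM A N γ).integrable_comp hint
  have hlim := MeasureTheory.tendsto_zero_of_hasDerivAt_of_integrableOn_Ioi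
    (fun t _ => hasDerivAt_exp_genLyapunovCLM K t) hint' hint
  have hftc := MeasureTheory.integral_Ioi_of_hasDerivAt_of_tendsto'
    (fun t _ => hasDerivAt_exp_genLyapunovCLM K t) hint' hlim
  rw [hP.eq_integral_exp, ← genLyapunovCLM_apply, ← ContinuousLinearMap.integral_comp_comm _ hint]
  simpa using hftc

theorem IsLyapunovIntegral.posSemidef {K P : Matrix (Fin n) (Fin n) ℝ}
    (hP : IsLyapunovIntegral A N γ K P) (hK : K.PosSemidef) : P.PosSemidef := by
  have hpos : ∀ t ∈ Set.Ioi (0 : ℝ),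
      (NormedSpace.exp (t • genLyapunovCLM A N γ) K).PosSemidef := fun t ht =>
    preservesPosSemidef_exp_genLyapunovCLM A N γ (le_of_lt ht) K hK
  have hint := hP.integrableOn_exp
  rw [hP.eq_integral_exp]
  refine Matrix.PosSemidef.of_dotProduct_mulVec_nonneg ?_ fun x => ?_
  · ext i j
    simp only [Matrix.conjTranspose_apply, star_trivial, integral_matrix_apply hint]
    refine MeasureTheory.setIntegral_congr_fun measurableSet_Ioi fun t ht => ?_
    simpa using (hpos t ht).1.apply i j
  · let φ : Matrix (Fin n) (Fin n) ℝ →ₗ[ℝ] ℝ :=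
      { toFun := fun M => star x ⬝ᵥ (M *ᵥ x)
        map_add' := fun X Y => by rw [Matrix.add_mulVec, dotProduct_add]
        map_smul' := fun c X => by rw [Matrix.smul_mulVec, dotProduct_smul]; rfl }
    have hφ := φ.toContinuousLinearMap.integral_comp_comm hint
    change 0 ≤ φ.toContinuousLinearMap _
    rw [← hφ]
    exact MeasureTheory.setIntegral_nonneg measurableSet_Ioi fun t ht =>
      (hpos t ht).dotProduct_mulVec_nonneg x

/-- A positive semidefinite `Θ` with `L Θ ≤ -K` bounds the integral of the orbit of `K`: the
nonnegative function `t ↦ tr (exp (t L) Θ)` decreases at least at the rate `tr (exp (t L) K)`. -/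
theorem exists_isLyapunovIntegral_of_supersolution {K Θ : Matrix (Fin n) (Fin n) ℝ}
    (hK : K.PosSemidef) (hΘ : Θ.PosSemidef) (hR : (-genLyapunov A N γ Θ - K).PosSemidef) :
    ∃ P, IsLyapunovIntegral A N γ K P := by
  let E : ℝ → Matrix (Fin n) (Fin n) ℝ →L[ℝ] Matrix (Fin n) (Fin n) ℝ :=
    fun t => NormedSpace.exp (t • genLyapunovCLM A N γ)
  have hE : ∀ t, 0 ≤ t → PreservesPosSemidef (E t) := fun t ht =>
    preservesPosSemidef_exp_genLyapunovCLM A N γ ht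
  let τ := (Matrix.traceLinearMap (Fin n) ℝ ℝ).toContinuousLinearMap
  have hτ : ∀ M, τ M = M.trace := fun _ => rfl
  have hderiv : ∀ t, HasDerivAt (fun s => τ (E s Θ)) (τ (E t (genLyapunov A N γ Θ))) t :=
    fun t => τ.hasFDerivAt.comp_hasDerivAt t (hasDerivAt_exp_genLyapunovCLM' Θ t)
  have hle : ∀ t, 0 ≤ t → τ (E t K) ≤ -τ (E t (genLyapunov A N γ Θ)) := fun t ht => by
    have h := (hE t ht _ hR).trace_nonneg
    rw [← hτ, map_sub, map_neg, map_sub, map_neg] at h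
    linarith
  have hK0 : ∀ t, 0 ≤ t → 0 ≤ τ (E t K) := fun t ht => (hE t ht K hK).trace_nonneg
  have hneg : ∀ t, 0 ≤ t → τ (E t (genLyapunov A N γ Θ)) ≤ 0 := fun t ht => by
    linarith [hle t ht, hK0 t ht]
  -- The function is only monotone on `[0, ∞)`, hence is frozen at `0` to the left of the origin.
  have hanti : Antitone fun t : ℝ => τ (E (max t 0) Θ) := by
    have h : AntitoneOn (fun t => τ (E t Θ)) (Set.Ici 0) :=
      antitoneOn_of_hasDerivWithinAt_nonpos (convex_Ici 0)
        (fun t _ => (hderiv t).continuousAt.continuousWithinAt)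
        (fun t _ => (hderiv t).hasDerivWithinAt)
        (fun t ht => hneg t (interior_subset ht))
    exact fun a b hab => h (le_max_right a 0) (le_max_right b 0) (max_le_max_right 0 hab)
  have hbdd : BddBelow (Set.range fun t : ℝ => τ (E (max t 0) Θ)) := by
    refine ⟨0, ?_⟩
    rintro _ ⟨t, rfl⟩
    exact (hE _ (le_max_right t 0) Θ hΘ).trace_nonneg
  have hlim := (tendsto_atTop_ciInf hanti hbdd).congr'
    (f₂ := fun t => τ (E t Θ)) (by
      filter_upwards [Filter.eventually_ge_atTop 0] with t ht
      rw [max_eq_left ht])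
  have hint := MeasureTheory.integrableOn_Ioi_deriv_of_nonpos' (fun t _ => hderiv t)
    (fun t ht => hneg t (le_of_lt ht)) hlim
  have hcont : Continuous fun t => E t K :=
    continuous_iff_continuousAt.2 fun t => (hasDerivAt_exp_genLyapunovCLM K t).continuousAt
  refine ⟨_, isLyapunovIntegral_of_integrableOn_exp (integrable_matrix_iff.2 fun i j => ?_)⟩
  refine hint.neg.mono' ?_ ?_
  · exact (hcont.matrix_elem i j).aestronglyMeasurable
  · filter_upwards [MeasureTheory.ae_restrict_mem measurableSet_Ioi] with t ht
    exact ((hE t (le_of_lt ht) K hK).abs_apply_le_trace i j).trans (hle t (le_of_lt ht))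

end Semigroup

end

/-! ### Changes of coordinates and compressions of the Lyapunov equation -/

section Compression

variable {n m r s q : ℕ}

theorem genLyapunov_conj (A : Matrix (Fin n) (Fin n) ℝ) (N : Fin m → Matrix (Fin n) (Fin n) ℝ)
    (γ : ℝ) (P : Matrix (Fin n) (Fin n) ℝ) {S : Matrix (Fin n) (Fin n) ℝ} (hS : IsUnit S.det) :
    genLyapunov (S * A * S⁻¹) (fun k => S * N k * S⁻¹) γ (S * P * Sᵀ)
      = S * genLyapunov A N γ P * Sᵀ := by
  have h₁ : ∀ B : Matrix (Fin n) (Fin n) ℝ, S * B * S⁻¹ * (S * P * Sᵀ) = S * (B * P) * Sᵀ := by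
    intro B
    simp only [Matrix.mul_assoc, Matrix.nonsing_inv_mul_cancel_left _ _ hS]
  have h₂ : ∀ B M : Matrix (Fin n) (Fin n) ℝ, S * M * Sᵀ * (S * B * S⁻¹)ᵀ = S * (M * Bᵀ) * Sᵀ := by
    intro B M
    have hST : IsUnit Sᵀ.det := by rwa [Matrix.det_transpose]
    simp only [Matrix.transpose_mul, Matrix.transpose_nonsing_inv, Matrix.mul_assoc,
      Matrix.mul_nonsing_inv_cancel_left _ _ hST]
  simp only [genLyapunov, h₁, h₂, Matrix.mul_add, Matrix.add_mul, Matrix.mul_smul,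
    Matrix.smul_mul, Finset.mul_sum, Finset.sum_mul]

/-- The `r × (r + s)` matrix `(1 X)`. -/
def oneAppend (X : Matrix (Fin r) (Fin s) ℝ) : Matrix (Fin r) (Fin (r + s)) ℝ :=
  Matrix.of fun i => Fin.append ((1 : Matrix (Fin r) (Fin r) ℝ) i) (X i)

open HomBilinearSystem

@[simp]
theorem leftCols_oneAppend (X : Matrix (Fin r) (Fin s) ℝ) : leftCols (oneAppend X) = 1 := by
  ext i j
  simp [leftCols, oneAppend]

@[simp]
theorem rightCols_oneAppend (X : Matrix (Fin r) (Fin s) ℝ) : rightCols (oneAppend X) = X := by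
  ext i j
  simp [rightCols, oneAppend]

theorem leftCols_oneAppend_mul (X : Matrix (Fin r) (Fin s) ℝ)
    (M : Matrix (Fin (r + s)) (Fin (r + s)) ℝ) :
    leftCols (oneAppend X * M) = block₁₁ M + X * block₂₁ M := by
  ext i j
  simp [leftCols, oneAppend, block₁₁, block₂₁, Matrix.mul_apply, Fin.sum_univ_add,
    Matrix.one_apply]

theorem rightCols_oneAppend_mul (X : Matrix (Fin r) (Fin s) ℝ)
    (M : Matrix (Fin (r + s)) (Fin (r + s)) ℝ) :
    rightCols (oneAppend X * M) = block₁₂ M + X * block₂₂ M := by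
  ext i j
  simp [rightCols, oneAppend, block₁₂, block₂₂, Matrix.mul_apply, Fin.sum_univ_add,
    Matrix.one_apply]

theorem oneAppend_mul (X : Matrix (Fin r) (Fin s) ℝ) (M : Matrix (Fin (r + s)) (Fin q) ℝ) :
    oneAppend X * M = topRows M + X * M.submatrix (Fin.natAdd r) id := by
  ext i j
  simp [oneAppend, topRows, Matrix.mul_apply, Fin.sum_univ_add, Matrix.one_apply]

theorem mul_diagonal_mul_transpose_eq (M T : Matrix (Fin r) (Fin (r + s)) ℝ)
    (θ : Fin (r + s) → ℝ) :
    M * Matrix.diagonal θ * Tᵀ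
      = leftCols M * Matrix.diagonal (fun i => θ (Fin.castAdd s i)) * (leftCols T)ᵀ
        + rightCols M * Matrix.diagonal (fun i => θ (Fin.natAdd r i)) * (rightCols T)ᵀ := by
  ext i j
  rw [Matrix.add_apply]
  simp only [Matrix.mul_apply (N := (_ : Matrix _ _ ℝ)ᵀ), Matrix.mul_diagonal,
    Matrix.transpose_apply, Fin.sum_univ_add, leftCols, rightCols, Matrix.submatrix_apply, id]

/-- Multiplying the equation `L (diag (Θ₁, Θ₂)) = -B Bᵀ` by `T = (1 X)` from the left and by `Tᵀ`
from the right shows that `Θ₁` is a supersolution for the compressed coefficients, provided that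
the term of `T A diag (Θ₁, Θ₂) Tᵀ` which involves `Θ₂` vanishes: the remaining defect
`γ⁻² ∑ k, Y k Θ₂ (Y k)ᵀ`, where `Y k` is the right block of `T N k`, is positive semidefinite. -/
theorem exists_isLyapunovIntegral_compression {A : Matrix (Fin (r + s)) (Fin (r + s)) ℝ}
    {N : Fin m → Matrix (Fin (r + s)) (Fin (r + s)) ℝ} {γ : ℝ}
    {B : Matrix (Fin (r + s)) (Fin q) ℝ} {θ : Fin (r + s) → ℝ} (hθ : ∀ i, 0 ≤ θ i)
    (hL : genLyapunov A N γ (Matrix.diagonal θ) = -(B * Bᵀ)) (X : Matrix (Fin r) (Fin s) ℝ)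
    (hX : (block₁₂ A + X * block₂₂ A) * Matrix.diagonal (fun i => θ (Fin.natAdd r i)) * Xᵀ = 0) :
    ∃ P, IsLyapunovIntegral (block₁₁ A + X * block₂₁ A)
      (fun k => block₁₁ (N k) + X * block₂₁ (N k)) γ
      (oneAppend X * B * (oneAppend X * B)ᵀ) P := by
  set θ₁ : Fin r → ℝ := fun i => θ (Fin.castAdd s i)
  set θ₂ : Fin s → ℝ := fun i => θ (Fin.natAdd r i)
  set T := oneAppend X with hT
  have hθ₁ : (Matrix.diagonal θ₁).PosSemidef := Matrix.PosSemidef.diagonal fun i => hθ _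
  have hθ₂ : (Matrix.diagonal θ₂).PosSemidef := Matrix.PosSemidef.diagonal fun i => hθ _
  refine exists_isLyapunovIntegral_of_supersolution (Matrix.posSemidef_self_mul_transpose _) hθ₁ ?_
  have hdrift : T * (A * Matrix.diagonal θ) * Tᵀ
      = (block₁₁ A + X * block₂₁ A) * Matrix.diagonal θ₁ := by
    rw [← Matrix.mul_assoc, mul_diagonal_mul_transpose_eq, leftCols_oneAppend_mul,
      rightCols_oneAppend_mul, leftCols_oneAppend, rightCols_oneAppend, hX]
    simp [θ₁]
  have hdrift' : T * (Matrix.diagonal θ * Aᵀ) * Tᵀ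
      = Matrix.diagonal θ₁ * (block₁₁ A + X * block₂₁ A)ᵀ := by
    have h := congrArg Matrix.transpose hdrift
    simpa only [Matrix.transpose_mul, Matrix.transpose_transpose, Matrix.diagonal_transpose,
      Matrix.mul_assoc] using h
  have hnoise : ∀ k, T * (N k * Matrix.diagonal θ * (N k)ᵀ) * Tᵀ
      = (block₁₁ (N k) + X * block₂₁ (N k)) * Matrix.diagonal θ₁
          * (block₁₁ (N k) + X * block₂₁ (N k))ᵀ
        + rightCols (T * N k) * Matrix.diagonal θ₂ * (rightCols (T * N k))ᵀ := by
    intro k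
    rw [← leftCols_oneAppend_mul, ← hT, ← mul_diagonal_mul_transpose_eq]
    simp only [Matrix.transpose_mul, Matrix.mul_assoc]
  have hred : -genLyapunov (block₁₁ A + X * block₂₁ A)
        (fun k => block₁₁ (N k) + X * block₂₁ (N k)) γ (Matrix.diagonal θ₁) - T * B * (T * B)ᵀ
      = (1 / γ ^ 2) •
        ∑ k, rightCols (T * N k) * Matrix.diagonal θ₂ * (rightCols (T * N k))ᵀ := by
    have h := congrArg (fun M => T * M * Tᵀ) hL
    simp only [genLyapunov, Matrix.mul_add T, Matrix.add_mul _ _ Tᵀ, Matrix.mul_smul,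
      Matrix.smul_mul, Matrix.mul_sum, Matrix.sum_mul, hdrift, hdrift', hnoise,
      Finset.sum_add_distrib, smul_add, Matrix.mul_neg, Matrix.neg_mul] at h
    have hB : T * B * (T * B)ᵀ = T * (B * Bᵀ) * Tᵀ := by
      simp only [Matrix.transpose_mul, Matrix.mul_assoc]
    rw [hB, ← neg_eq_iff_eq_neg.2 h]
    simp only [genLyapunov]
    abel
  rw [hred]
  exact (Matrix.posSemidef_sum _ fun k _ => hθ₂.mul_mul_transpose_same _).smul (by positivity)

/-- In balanced coordinates a Gramian is `diag θ`, and it still solves its Lyapunov equation. -/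
theorem IsLyapunovIntegral.diagonal_of_conj {A : Matrix (Fin n) (Fin n) ℝ}
    {N : Fin m → Matrix (Fin n) (Fin n) ℝ} {γ : ℝ} {B : Matrix (Fin n) (Fin q) ℝ}
    {P S : Matrix (Fin n) (Fin n) ℝ} {θ : Fin n → ℝ}
    (hP : IsLyapunovIntegral A N γ (B * Bᵀ) P) (hS : IsUnit S.det)
    (hθ : S * P * Sᵀ = Matrix.diagonal θ) :
    (∀ i, 0 ≤ θ i) ∧ genLyapunov (S * A * S⁻¹) (fun k => S * N k * S⁻¹) γ (Matrix.diagonal θ)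
      = -(S * B * (S * B)ᵀ) := by
  constructor
  · have h := (hP.posSemidef (Matrix.posSemidef_self_mul_transpose B)).mul_mul_transpose_same S
    rw [hθ] at h
    exact Matrix.posSemidef_diagonal_iff.1 h
  · rw [← hθ, genLyapunov_conj _ _ _ _ hS, hP.genLyapunov_eq]
    simp only [Matrix.transpose_mul, Matrix.mul_assoc, Matrix.mul_neg, Matrix.neg_mul]

end Compression

/-! ### Gramians of the reduced systems -/

theorem theorem4p2 (r s m q p : ℕ) (sys : HomBilinearSystem (r + s) m q p)
    (hA : IsHurwitzMatrix sys.A)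
    (γ : ℝ) (hγ : 0 < γ) (hstab : IsHurwitzMatrix (sys.kroneckerMatrix γ))
    (P₀ Q : Matrix (Fin (r + s)) (Fin (r + s)) ℝ)
    (hP₀ : sys.IsReachabilityGramian γ P₀) (hQ : sys.IsObservabilityGramian γ Q)
    (S : Matrix (Fin (r + s)) (Fin (r + s)) ℝ) (θ : Fin (r + s) → ℝ)
    (hS : HomBilinearSystem.IsBalancingTransformation P₀ Q S θ)
    (hθ₁ : ∀ i : Fin r, 0 < θ (Fin.castAdd s i)) :
    ((∃ P', (sys.transform S).truncation.IsReachabilityGramian γ P') ∧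
      (∃ Q', (sys.transform S).truncation.IsObservabilityGramian γ Q')) ∧
    (IsUnit (HomBilinearSystem.block₂₂ (sys.transform S).A).det →
      ∃ Q', (sys.transform S).singularPerturbation.IsObservabilityGramian γ Q') := by
  obtain ⟨hdet, hP, hQθ⟩ := hS
  obtain ⟨hθ, hLP⟩ := IsLyapunovIntegral.diagonal_of_conj hP₀ hdet hP
  -- The observability Gramian is transformed by `R = S⁻ᵀ`, for which `R Aᵀ R⁻¹ = (S A S⁻¹)ᵀ`.
  have hR : IsUnit (S⁻¹)ᵀ.det := by
    rw [Matrix.det_transpose]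
    exact (Matrix.isUnit_nonsing_inv_det_iff).2 hdet
  have hRinv : ((S⁻¹)ᵀ)⁻¹ = Sᵀ := by
    rw [← Matrix.transpose_nonsing_inv, Matrix.nonsing_inv_nonsing_inv _ hdet]
  have hconj : ∀ M : Matrix (Fin (r + s)) (Fin (r + s)) ℝ,
      (S⁻¹)ᵀ * Mᵀ * Sᵀ = (S * M * S⁻¹)ᵀ := fun M => by
    simp only [Matrix.transpose_mul, Matrix.mul_assoc]
  have hQ' : IsLyapunovIntegral sys.Aᵀ (fun k => (sys.N k)ᵀ) γ (sys.Cᵀ * (sys.Cᵀ)ᵀ) Q := by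
    rw [Matrix.transpose_transpose]
    exact hQ
  obtain ⟨-, hLQ⟩ := hQ'.diagonal_of_conj hR (by rw [Matrix.transpose_transpose]; exact hQθ)
  simp only [hRinv, hconj, ← Matrix.transpose_mul sys.C] at hLQ
  refine ⟨⟨?_, ?_⟩, fun hu => ?_⟩
  · have h := exists_isLyapunovIntegral_compression hθ hLP 0 (by simp)
    simp only [oneAppend_mul, Matrix.zero_mul, add_zero] at h
    exact h
  · have h := exists_isLyapunovIntegral_compression hθ hLQ 0 (by simp)
    simp only [oneAppend_mul, Matrix.zero_mul, add_zero] at h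
    exact h
  · -- For `X = -(A₂₂⁻¹ A₂₁)ᵀ` the right block `A₂₁ᵀ + X A₂₂ᵀ` of `(1 X) Aᵀ` vanishes.
    set sysT := sys.transform S
    set X : Matrix (Fin r) (Fin s) ℝ :=
      -((HomBilinearSystem.block₂₂ sysT.A)⁻¹ * HomBilinearSystem.block₂₁ sysT.A)ᵀ with hXdef
    have h₁₁ : ∀ M : Matrix (Fin (r + s)) (Fin (r + s)) ℝ,
        HomBilinearSystem.block₁₁ Mᵀ = (HomBilinearSystem.block₁₁ M)ᵀ := fun _ => rfl
    have h₂₁ : ∀ M : Matrix (Fin (r + s)) (Fin (r + s)) ℝ,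
        HomBilinearSystem.block₂₁ Mᵀ = (HomBilinearSystem.block₁₂ M)ᵀ := fun _ => rfl
    have hzero : HomBilinearSystem.block₁₂ (S * sys.A * S⁻¹)ᵀ
        + X * HomBilinearSystem.block₂₂ (S * sys.A * S⁻¹)ᵀ = 0 := by
      change (HomBilinearSystem.block₂₁ sysT.A)ᵀ + X * (HomBilinearSystem.block₂₂ sysT.A)ᵀ = 0
      rw [hXdef, Matrix.neg_mul, ← Matrix.transpose_mul, Matrix.mul_nonsing_inv_cancel_left _ _ hu,
        add_neg_cancel]
    have h := exists_isLyapunovIntegral_compression hθ hLQ X (by rw [hzero]; simp)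
    have hcompress : ∀ M : Matrix (Fin (r + s)) (Fin (r + s)) ℝ,
        HomBilinearSystem.block₁₁ Mᵀ + X * HomBilinearSystem.block₂₁ Mᵀ
          = (HomBilinearSystem.block₁₁ M - HomBilinearSystem.block₁₂ M
            * (HomBilinearSystem.block₂₂ sysT.A)⁻¹ * HomBilinearSystem.block₂₁ sysT.A)ᵀ :=
      fun M => by
        rw [h₁₁, h₂₁, hXdef, Matrix.neg_mul, ← Matrix.transpose_mul, Matrix.transpose_sub,
          ← sub_eq_add_neg, Matrix.mul_assoc]
    have hout : oneAppend X * (sys.C * S⁻¹)ᵀ = (sysT.singularPerturbation.C)ᵀ := by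
      rw [oneAppend_mul]
      change (HomBilinearSystem.leftCols sysT.C)ᵀ + X * (HomBilinearSystem.rightCols sysT.C)ᵀ = _
      rw [hXdef, Matrix.neg_mul, ← Matrix.transpose_mul, ← sub_eq_add_neg,
        ← Matrix.transpose_sub, ← Matrix.mul_assoc]
      rfl
    simp only [hcompress, hout, Matrix.transpose_transpose] at h
    exact h
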